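/- Let $(T,d)$ be a compact metric space with Borel $\sigma$-algebra $\Sigma$, and let $\mu:\Sigma\to[0,\infty)$ be a finite (hence regular, i.e. Radon) measure that is pointwise non-atomic, i.e. $\mu(\{t\})=0$ for every $t\in T$. Let $L$ be an $L$-space, i.e. a (real) Banach lattice with $\|u+v\|=\|u\|+\|v\|$ for all $u,v\in L$ with $u,v\ge 0$. A *gauge* is any function $\gamma:T\to(0,\infty)$. A *Henstock partition* of $T$ is a finite family $\Pi=\{(E_i,t_i):i=1,\dots,q\}$ with $E_i\in\Sigma$, $t_i\in E_i$, $\mu(E_i\cap E_j)=0$ for $i\ne j$ and $\bigcup_i E_i=T$; it is *$\gamma$-fine* if $d(w,t_i)<\gamma(t_i)$ for all $i$ and all $w\in E_i$. An *$(o)$-sequence* in $L$ is a decreasing sequence $(b_n)_n$ with $\inf_n b_n=0$. A function $f:T\to L$ is *order-Henstock integrable* ((oH)-integrable) if there exist $J\in L$, an $(o)$-sequence $(b_n)_n$ in $L$ and a sequence $(\gamma_n)_n$ of gauges such that, for every $n$ and every $\gamma_n$-fine Henstock partition $\{(E_i,t_i):i=1,\dots,q\}$ of $T$, $$\Big|\sum_{i=1}^q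 \mu(E_i)\,f(t_i)-J\Big|\le b_n,$$ where $|\cdot|$ is the modulus of $L$. Theorem. If $f:T\to L$ is (oH)-integrable with respect to $\mu$, then $f$ is Bochner integrable with respect to $\mu$. -/

import Mathlib

open MeasureTheory

namespace OrderHenstock

/-- An `L`-space, as a property of a Banach lattice: the norm is additive on the positive cone.
The Banach lattice structure itself is given by type classes. -/
def IsLSpace (L : Type*) [NormedAddCommGroup L] [Lattice L] : Prop :=
  ∀ u v : L, 0 ≤ u → 0 ≤ v → ‖u + v‖ = ‖u‖ + ‖v‖

/-- An `(o)`-sequence: a decreasing sequence whose infimum is `0`. -/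
def IsOSequence {X : Type*} [AddCommGroup X] [Lattice X] (b : ℕ → X) : Prop :=
  Antitone b ∧ IsGLB (Set.range b) 0

/-- A gauge is an arbitrary strictly positive function. -/
def IsGauge {T : Type*} (γ : T → ℝ) : Prop :=
  ∀ t, 0 < γ t

/-- The finite family of pairs `(E i, t i)` is a Henstock (Perron) partition of `T`: the `E i` are
measurable, overlap pairwise in null sets and cover `T`, and each tag `t i` lies in `E i`. -/
structure IsHenstockPartition {T : Type*} [MeasurableSpace T] (μ : Measure T) {q : ℕ}
    (E : Fin q → Set T) (t : Fin q → T) : Prop where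
  measurableSet : ∀ i, MeasurableSet (E i)
  null_inter : ∀ i j, i ≠ j → μ (E i ∩ E j) = 0
  iUnion_eq : ⋃ i, E i = Set.univ
  tag_mem : ∀ i, t i ∈ E i

/-- The family of pairs `(E i, t i)` is `γ`-fine. -/
def IsFine {T : Type*} [MetricSpace T] (γ : T → ℝ) {q : ℕ}
    (E : Fin q → Set T) (t : Fin q → T) : Prop :=
  ∀ i, ∀ w ∈ E i, dist w (t i) < γ (t i)

/-- The Riemann sum `∑ i, f (t i) μ(E i)`. -/
noncomputable def riemannSum {T X : Type*} [MeasurableSpace T] [NormedAddCommGroup X]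
    [NormedSpace ℝ X] (μ : Measure T) (f : T → X) {q : ℕ}
    (E : Fin q → Set T) (t : Fin q → T) : X :=
  ∑ i, μ.real (E i) • f (t i)

/-- Order-Henstock integrability, (oH)-integrability for short. -/
def OHIntegrable {T X : Type*} [MetricSpace T] [MeasurableSpace T] [NormedAddCommGroup X]
    [NormedSpace ℝ X] [Lattice X] (μ : Measure T) (f : T → X) : Prop :=
  ∃ (J : X) (b : ℕ → X) (γ : ℕ → T → ℝ),
    IsOSequence b ∧ (∀ n, IsGauge (γ n)) ∧
      ∀ (n q : ℕ) (E : Fin q → Set T) (t : Fin q → T),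
        IsHenstockPartition μ E t → IsFine (γ n) E t → |riemannSum μ f E t - J| ≤ b n

end OrderHenstock

open Filter Topology
open scoped ENNReal

namespace OrderHenstock

section LSpace

variable {L : Type*} [NormedAddCommGroup L] [Lattice L] [IsOrderedAddMonoid L]

/-! Take two simple tag functions `σ`, `τ`, both fine for `γ n`. Exchanging their tags independently
on each cell of the common refinement leaves every Riemann sum within `b n` of `J`. With all choices
of signs, this bounds the sum of the moduli `|μ(E) (f σ - f τ)|` by `2 b n`. Additivity of the norm
turns this order bound into `∫ ‖f ∘ σ - f ∘ τ‖ ≤ 2 ‖b n‖`, which tends to `0` by order continuity of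
the norm.

To reach `f` itself, tags are placed inside the set where `f` is far from `f ∘ τ n`; the same
estimate shows that this set has small outer measure. Hence `f ∘ τ n → f` in measure, so `f` is
strongly measurable, and a uniform `L¹` bound passes to the limit. -/

theorem IsLSpace.norm_sum (hL : IsLSpace L) {ι : Type*} (s : Finset ι) {x : ι → L}
    (hx : ∀ i ∈ s, 0 ≤ x i) : ‖∑ i ∈ s, x i‖ = ∑ i ∈ s, ‖x i‖ := by
  classical
  induction s using Finset.induction_on with
  | empty => simp
  | insert a s ha ih =>
    have hs : ∀ i ∈ s, 0 ≤ x i := fun i hi => hx i (Finset.mem_insert_of_mem hi)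
    rw [Finset.sum_insert ha, Finset.sum_insert ha,
      hL _ _ (hx a (Finset.mem_insert_self a s)) (Finset.sum_nonneg hs), ih hs]

/-- The norm of an `L`-space is order continuous along `(o)`-sequences. -/
theorem IsLSpace.tendsto_norm_of_isOSequence [HasSolidNorm L] [CompleteSpace L]
    (hL : IsLSpace L) {b : ℕ → L} (hb : IsOSequence b) :
    Tendsto (fun n => ‖b n‖) atTop (𝓝 0) := by
  obtain ⟨hanti, hglb⟩ := hb
  have hnonneg : ∀ n, 0 ≤ b n := fun n => hglb.1 ⟨n, rfl⟩
  have hsub : ∀ n m, n ≤ m → ‖b n - b m‖ = ‖b n‖ - ‖b m‖ := fun n m hnm => by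
    have h := hL (b n - b m) (b m) (sub_nonneg.2 (hanti hnm)) (hnonneg m)
    rw [sub_add_cancel] at h
    linarith
  have hnorm : Antitone fun n => ‖b n‖ := fun n m hnm => by
    have h := norm_nonneg (b n - b m)
    rw [hsub n m hnm] at h
    exact sub_nonneg.1 h
  have hlim : CauchySeq fun n => ‖b n‖ :=
    (tendsto_atTop_ciInf hnorm ⟨0, by rintro _ ⟨n, rfl⟩; exact norm_nonneg _⟩).cauchySeq
  have hcauchy : CauchySeq b := by
    rw [Metric.cauchySeq_iff'] at hlim ⊢
    intro ε hε
    obtain ⟨N, hN⟩ := hlim ε hε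
    refine ⟨N, fun n hn => ?_⟩
    have h := hN n hn
    rw [Real.dist_eq, abs_sub_comm] at h
    rw [dist_comm, dist_eq_norm, hsub N n hn]
    exact (le_abs_self _).trans_lt h
  obtain ⟨l, hl⟩ := cauchySeq_tendsto_of_complete hcauchy
  have hl0 : l = 0 := le_antisymm
    (hglb.2 (by rintro _ ⟨n, rfl⟩; exact hanti.le_of_tendsto hl n))
    (ge_of_tendsto' hl hnonneg)
  simpa [hl0] using hl.norm

/-- In an abelian lattice group, `∑ |x i|` is the least upper bound of the sums `∑ ± x i`. -/
theorem sum_abs_le_of_forall_sum_sign_le {ι : Type*} (s : Finset ι) (x : ι → L) (c : L)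
    (h : ∀ y : ι → L, (∀ i, y i = x i ∨ y i = -x i) → ∑ i ∈ s, y i ≤ c) :
    ∑ i ∈ s, |x i| ≤ c := by
  classical
  induction s using Finset.induction_on generalizing c with
  | empty => simpa using h x fun _ => Or.inl rfl
  | insert a s ha ih =>
    rw [Finset.sum_insert ha, ← le_sub_iff_add_le']
    refine ih _ fun y hy => ?_
    have key : ∀ z, (z = x a ∨ z = -x a) → z + ∑ i ∈ s, y i ≤ c := fun z hz => by
      have h' := h (Function.update y a z) fun i => by
        by_cases hi : i = a
        · subst hi; simpa using hz
        · simpa [hi] using hy i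
      rwa [Finset.sum_insert ha, Function.update_self, Finset.sum_update_of_notMem ha] at h'
    rw [le_sub_comm, abs_le']
    exact ⟨le_sub_iff_add_le.2 (key _ (Or.inl rfl)), le_sub_iff_add_le.2 (key _ (Or.inr rfl))⟩

end LSpace

section TagFunctions

variable {T : Type*} [MetricSpace T] [MeasurableSpace T]

/-- A simple function `τ`, sending every point to the tag of its cell, is `γ`-fine. -/
def IsFineTag (γ : T → ℝ) (τ : T → T) : Prop :=
  ∀ w, dist w (τ w) < γ (τ w)

theorem exists_isFineTag [CompactSpace T] [OpensMeasurableSpace T] [Nonempty T] {γ : T → ℝ}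
    (hγ : IsGauge γ) : ∃ τ : SimpleFunc T T, IsFineTag γ τ := by
  classical
  obtain ⟨s, hs⟩ := (isCompact_univ (X := T)).elim_finite_subcover
    (fun t => Metric.ball t (γ t)) (fun _ => Metric.isOpen_ball)
    (fun t _ => Set.mem_iUnion.2 ⟨t, Metric.mem_ball_self (hγ t)⟩)
  have key : ∀ s : Finset T, ∃ τ : SimpleFunc T T,
      ∀ w ∈ ⋃ t ∈ s, Metric.ball t (γ t), dist w (τ w) < γ (τ w) := fun s => by
    induction s using Finset.induction_on with
    | empty => exact ⟨SimpleFunc.const T (Classical.arbitrary T), by simp⟩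
    | insert a s _ ih =>
      obtain ⟨τ, hτ⟩ := ih
      refine ⟨SimpleFunc.piecewise (Metric.ball a (γ a)) Metric.isOpen_ball.measurableSet
        (SimpleFunc.const T a) τ, fun w hw => ?_⟩
      rw [SimpleFunc.piecewise_apply]
      split_ifs with hwa
      · exact hwa
      · rw [Finset.set_biUnion_insert] at hw
        exact hτ w (hw.resolve_left hwa)
  obtain ⟨τ, hτ⟩ := key s
  exact ⟨τ, fun w => hτ w (hs (Set.mem_univ w))⟩

/-- For a non-atomic measure, Riemann sums over Henstock partitions control the Riemann sums in
which the tags need not lie in their cells. -/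
theorem abs_sum_sub_le_of_isFineTag [BorelSpace T] {μ : Measure T} (hμ : ∀ t : T, μ {t} = 0)
    {X : Type*} [NormedAddCommGroup X] [NormedSpace ℝ X] [Lattice X] {f : T → X} {γ : T → ℝ}
    (hγ : IsGauge γ) {J b : X}
    (h : ∀ (q : ℕ) (E : Fin q → Set T) (t : Fin q → T),
      IsHenstockPartition μ E t → IsFine γ E t → |riemannSum μ f E t - J| ≤ b)
    {α : Type*} (p : SimpleFunc T α) (g : α → T) (hg : IsFineTag γ fun w => g (p w)) :
    |∑ x ∈ p.range, μ.real (p ⁻¹' {x}) • f (g x) - J| ≤ b := by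
  let e := p.range.equivFin
  let c : Fin p.range.card → α := fun i => (e.symm i : α)
  have hc : Function.Injective c := Subtype.val_injective.comp e.symm.injective
  -- Adjoining the tag makes it a member of its cell; by non-atomicity only null sets change.
  let E : Fin p.range.card → Set T := fun i => p ⁻¹' {c i} ∪ {g (c i)}
  have hpart : IsHenstockPartition μ E fun i => g (c i) :=
    { measurableSet := fun i => (p.measurableSet_preimage _).union (measurableSet_singleton _)
      null_inter := fun i j hij => by
        refine measure_mono_null (t := {g (c i)} ∪ {g (c j)}) ?_
          (measure_union_null (hμ _) (hμ _))
        rintro w ⟨hi | hi, hj | hj⟩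
        · exact absurd (hc (hi.symm.trans hj)) hij
        · exact Or.inr hj
        · exact Or.inl hi
        · exact Or.inl hi
      iUnion_eq := Set.eq_univ_of_forall fun w => Set.mem_iUnion.2
        ⟨e ⟨p w, p.mem_range_self w⟩, Or.inl (by simp [c])⟩
      tag_mem := fun i => Or.inr rfl }
  have hfine : IsFine γ E fun i => g (c i) := by
    rintro i w (hw | hw)
    · have hw' : p w = c i := hw
      simpa only [hw'] using hg w
    · rw [Set.mem_singleton_iff.1 hw, dist_self]
      exact hγ _
  have hsum : riemannSum μ f E (fun i => g (c i)) =
      ∑ x ∈ p.range, μ.real (p ⁻¹' {x}) • f (g x) := by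
    have hreal : ∀ i, μ.real (E i) = μ.real (p ⁻¹' {c i}) := fun i => by
      simp only [Measure.real, E]
      rw [measure_congr (union_ae_eq_left_of_ae_eq_empty (ae_eq_empty.2 (hμ _)))]
    rw [← Finset.sum_coe_sort, ← e.symm.sum_comp]
    exact Finset.sum_congr rfl fun i _ => by rw [hreal i]
  rw [← hsum]
  exact h _ E _ hpart hfine

/-- Riemann sums over a common partition with exchanged tags differ little, even when absolute
values are taken inside the sum. -/
theorem lintegral_edist_comp_le [BorelSpace T] {μ : Measure T} [IsFiniteMeasure μ]
    (hμ : ∀ t : T, μ {t} = 0) {L : Type*} [NormedAddCommGroup L] [NormedSpace ℝ L] [Lattice L]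
    [IsOrderedAddMonoid L] [HasSolidNorm L] (hL : IsLSpace L)
    {f : T → L} {γ : T → ℝ} (hγ : IsGauge γ) {J b : L}
    (h : ∀ (q : ℕ) (E : Fin q → Set T) (t : Fin q → T),
      IsHenstockPartition μ E t → IsFine γ E t → |riemannSum μ f E t - J| ≤ b)
    {σ τ : SimpleFunc T T} (hσ : IsFineTag γ σ) (hτ : IsFineTag γ τ) :
    ∫⁻ w, edist (f (σ w)) (f (τ w)) ∂μ ≤ ENNReal.ofReal ‖b + b‖ := by
  classical
  let p : SimpleFunc T (T × T) := σ.pair τ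
  let m : T × T → ℝ := fun x => μ.real (p ⁻¹' {x})
  have hm : ∀ x, 0 ≤ m x := fun x => measureReal_nonneg
  let d : T × T → L := fun x => m x • f x.1 - m x • f x.2
  have hfine : ∀ g : T × T → T, (∀ x, g x = x.1 ∨ g x = x.2) → IsFineTag γ fun w => g (p w) :=
    fun g hg w => by
      rcases hg (p w) with hw | hw <;> simp only [hw]
      · exact hσ w
      · exact hτ w
  have hsum : ∑ x ∈ p.range, |d x| ≤ b + b := by
    refine sum_abs_le_of_forall_sum_sign_le _ _ _ fun y hy => ?_
    -- A minus sign exchanges the two tags, so the signed sum is a difference of two admissible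
    -- Riemann sums.
    let g : T × T → T := fun x => if y x = d x then x.1 else x.2
    let g' : T × T → T := fun x => if y x = d x then x.2 else x.1
    have hg := abs_sum_sub_le_of_isFineTag hμ hγ h p g
      (hfine g fun x => by simp only [g]; split_ifs <;> simp)
    have hg' := abs_sum_sub_le_of_isFineTag hμ hγ h p g'
      (hfine g' fun x => by simp only [g']; split_ifs <;> simp)
    have hy' : ∀ x, y x = m x • f (g x) - m x • f (g' x) := fun x => by
      by_cases hx : y x = d x
      · simp only [g, g', if_pos hx]
        exact hx
      · simp only [g, g', if_neg hx]
        rw [(hy x).resolve_left hx, neg_sub]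
    calc ∑ x ∈ p.range, y x
        = (∑ x ∈ p.range, m x • f (g x) - J) + -(∑ x ∈ p.range, m x • f (g' x) - J) := by
          rw [Finset.sum_congr rfl fun x _ => hy' x, Finset.sum_sub_distrib]
          abel
      _ ≤ b + b := add_le_add ((le_abs_self _).trans hg) ((neg_le_abs _).trans hg')
  have hnorm : ∑ x ∈ p.range, m x * dist (f x.1) (f x.2) ≤ ‖b + b‖ := by
    have hd : ∀ x, m x * dist (f x.1) (f x.2) = ‖|d x|‖ := fun x => by
      rw [norm_abs_eq_norm, show d x = m x • (f x.1 - f x.2) from (smul_sub _ _ _).symm,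
        norm_smul, Real.norm_of_nonneg (hm x), dist_eq_norm]
    rw [Finset.sum_congr rfl fun x _ => hd x, ← hL.norm_sum _ fun x _ => abs_nonneg (d x)]
    have h0 : 0 ≤ ∑ x ∈ p.range, |d x| := Finset.sum_nonneg fun x _ => abs_nonneg _
    refine norm_le_norm_of_abs_le_abs ?_
    rwa [abs_of_nonneg h0, abs_of_nonneg (h0.trans hsum)]
  calc ∫⁻ w, edist (f (σ w)) (f (τ w)) ∂μ
      = ∫⁻ w, (p.map fun x => edist (f x.1) (f x.2)) w ∂μ := rfl
    _ = ∑ x ∈ p.range, edist (f x.1) (f x.2) * μ (p ⁻¹' {x}) := by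
      rw [SimpleFunc.lintegral_eq_lintegral, SimpleFunc.map_lintegral]
    _ = ENNReal.ofReal (∑ x ∈ p.range, m x * dist (f x.1) (f x.2)) := by
      rw [ENNReal.ofReal_sum_of_nonneg fun x _ => mul_nonneg (hm x) dist_nonneg]
      refine Finset.sum_congr rfl fun x _ => ?_
      rw [ENNReal.ofReal_mul (hm x), ← edist_dist, ofReal_measureReal, mul_comm]
    _ ≤ ENNReal.ofReal ‖b + b‖ := ENNReal.ofReal_le_ofReal hnorm

/-- A simple function that is `L¹`-close to all `γ`-fine step functions of `f` is close to `f` in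
measure. Neither `f` nor `γ` is assumed measurable. -/
theorem mul_measure_le_of_forall_isFineTag [CompactSpace T] [BorelSpace T] {μ : Measure T}
    {X : Type*} [PseudoEMetricSpace X] {f : T → X} {γ : T → ℝ} (hγ : IsGauge γ)
    (h : SimpleFunc T X) {ε : ℝ≥0∞}
    (hε : ∀ τ : SimpleFunc T T, IsFineTag γ τ → ∫⁻ w, edist (h w) (f (τ w)) ∂μ ≤ ε) (δ : ℝ≥0∞) :
    δ * μ {w | δ ≤ edist (h w) (f w)} ≤ ε := by
  classical
  rcases isEmpty_or_nonempty T with hT | hT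
  · simp [Measure.eq_zero_of_isEmpty μ]
  obtain ⟨τ₀, hτ₀⟩ := exists_isFineTag hγ
  -- On `D k` the gauge has a uniform lower bound, so a point of `D k` may tag any small cell
  -- containing it. Continuity from below holds for outer measure, so `D k` need not be measurable.
  let D : ℕ → Set T := fun k => {w | δ ≤ edist (h w) (f w) ∧ 1 / ((k : ℝ) + 1) < γ w}
  have hD : {w | δ ≤ edist (h w) (f w)} = ⋃ k, D k := by
    ext w
    simp only [Set.mem_iUnion]
    refine ⟨fun hw => ?_, fun ⟨k, hk⟩ => hk.1⟩
    obtain ⟨k, hk⟩ := exists_nat_one_div_lt (hγ w)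
    exact ⟨k, hw, hk⟩
  have hmono : Monotone D := fun k l hkl w hw =>
    ⟨hw.1, (one_div_le_one_div_of_le (by positivity) (by gcongr)).trans_lt hw.2⟩
  rw [hD, hmono.measure_iUnion, ENNReal.mul_iSup]
  refine iSup_le fun k => ?_
  obtain ⟨ρ, hρ⟩ := exists_isFineTag (T := T) (γ := fun _ => 1 / ((k : ℝ) + 1) / 2)
    (fun _ => by positivity)
  -- On a cell of `q` points are less than `1 / (k + 1)` apart and `h` is constant. Each cell
  -- meeting `D k` is tagged by one of its points in `D k`, so the lower bound `δ` spreads to the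
  -- whole measurable cell.
  let q : SimpleFunc T (T × X) := ρ.pair h
  let Y : Set (T × X) := {y | ∃ w ∈ D k, q w = y}
  let c : T × X → T := fun y => if hy : y ∈ Y then hy.choose else Classical.arbitrary T
  have hc : ∀ y ∈ Y, c y ∈ D k ∧ q (c y) = y := fun y hy => by
    simp only [c, dif_pos hy]
    exact hy.choose_spec
  let τ : SimpleFunc T T :=
    SimpleFunc.piecewise (q ⁻¹' Y) (q.measurableSet_preimage Y) (q.map c) τ₀
  have hτY : ∀ w, q w ∈ Y → τ w = c (q w) := fun w hw => if_pos hw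
  have hτ : IsFineTag γ τ := fun w => by
    by_cases hw : q w ∈ Y
    · obtain ⟨hD', hq⟩ := hc _ hw
      have hρeq : ρ (c (q w)) = ρ w := congrArg Prod.fst hq
      have h1 := hρ w
      have h2 := hρ (c (q w))
      rw [hρeq] at h2
      rw [hτY w hw]
      calc dist w (c (q w)) ≤ dist w (ρ w) + dist (c (q w)) (ρ w) := dist_triangle_right _ _ _
        _ < 1 / ((k : ℝ) + 1) / 2 + 1 / ((k : ℝ) + 1) / 2 := add_lt_add h1 h2
        _ = 1 / ((k : ℝ) + 1) := add_halves _
        _ < γ (c (q w)) := hD'.2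
    · have : τ w = τ₀ w := if_neg hw
      rw [this]
      exact hτ₀ w
  have hsub : D k ⊆ {w | δ ≤ edist (h w) (f (τ w))} := fun w hw => by
    have hwY : q w ∈ Y := ⟨w, hw, rfl⟩
    obtain ⟨hD', hq⟩ := hc _ hwY
    have hheq : h (c (q w)) = h w := congrArg Prod.snd hq
    have := hD'.1
    rw [hheq] at this
    simpa only [Set.mem_ofPred_eq, hτY w hwY] using this
  have hmeas : Measurable fun w => edist (h w) (f (τ w)) :=
    ((h.pair τ).map fun x : X × T => edist x.1 (f x.2)).measurable
  calc δ * μ (D k) ≤ δ * μ {w | δ ≤ edist (h w) (f (τ w))} := by gcongr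
    _ ≤ ∫⁻ w, edist (h w) (f (τ w)) ∂μ := mul_meas_ge_le_lintegral hmeas δ
    _ ≤ ε := hε τ hτ

end TagFunctions

end OrderHenstock

theorem theorem3 {T : Type*} [MetricSpace T] [CompactSpace T] [MeasurableSpace T] [BorelSpace T]
    (μ : MeasureTheory.Measure T) [MeasureTheory.IsFiniteMeasure μ] (hμ : ∀ t : T, μ {t} = 0)
    {L : Type*} [NormedAddCommGroup L] [NormedSpace ℝ L] [CompleteSpace L]
    [Lattice L] [IsOrderedAddMonoid L] [IsOrderedModule ℝ L] [HasSolidNorm L]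
    (hL : OrderHenstock.IsLSpace L) (f : T → L) (hf : OrderHenstock.OHIntegrable μ f) :
    MeasureTheory.Integrable f μ := by
  rcases isEmpty_or_nonempty T with hT | hT
  · simp [MeasureTheory.Measure.eq_zero_of_isEmpty μ]
  obtain ⟨J, b, γ, hb, hγ, h⟩ := hf
  -- Keeping every `τ n` fine for `γ 0` as well allows comparison with `g 0`, which gives the
  -- uniform `L¹` bound.
  have hγ' : ∀ n, OrderHenstock.IsGauge fun t => min (γ 0 t) (γ n t) := fun n t => lt_min (hγ 0 t) (hγ n t)
  choose τ hτ using fun n => OrderHenstock.exists_isFineTag (hγ' n)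
  have hτ0 : ∀ n, OrderHenstock.IsFineTag (γ 0) (τ n) := fun n w => (hτ n w).trans_le (min_le_left _ _)
  have hτn : ∀ n, OrderHenstock.IsFineTag (γ n) (τ n) := fun n w => (hτ n w).trans_le (min_le_right _ _)
  let g : ℕ → SimpleFunc T L := fun n => (τ n).map f
  have hg : ∀ n, AEStronglyMeasurable (g n) μ := fun n => (g n).aestronglyMeasurable
  have hlim : Tendsto (fun n => ENNReal.ofReal ‖b n + b n‖) atTop (𝓝 0) := by
    have h2 := hL.tendsto_norm_of_isOSequence hb
    have h3 : Tendsto (fun n => ENNReal.ofReal (‖b n‖ + ‖b n‖)) atTop (𝓝 0) := by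
      simpa using ENNReal.tendsto_ofReal (h2.add h2)
    refine h3.congr fun n => ?_
    have hn : 0 ≤ b n := hb.2.1 ⟨n, rfl⟩
    rw [hL _ _ hn hn]
  have hmeas : TendstoInMeasure μ (fun n => g n) atTop f := by
    refine tendstoInMeasure_of_ne_top fun δ hδ hδ' => ?_
    have hdiv : Tendsto (fun n => ENNReal.ofReal ‖b n + b n‖ / δ) atTop (𝓝 0) := by
      simpa using ENNReal.Tendsto.div_const hlim (Or.inr hδ.ne')
    refine tendsto_of_tendsto_of_tendsto_of_le_of_le tendsto_const_nhds hdiv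
      (fun _ => zero_le) fun n => ?_
    rw [ENNReal.le_div_iff_mul_le (Or.inl hδ.ne') (Or.inl hδ'), mul_comm]
    exact OrderHenstock.mul_measure_le_of_forall_isFineTag (hγ n) (g n)
      (fun σ hσ => OrderHenstock.lintegral_edist_comp_le hμ hL (hγ n) (h n) (hτn n) hσ) δ
  refine memLp_one_iff_integrable.1 ⟨hmeas.aestronglyMeasurable hg, ?_⟩
  have hbound : ∀ n, eLpNorm (g n) 1 μ ≤ ENNReal.ofReal ‖b 0 + b 0‖ + eLpNorm (g 0) 1 μ :=
    fun n => by
      calc eLpNorm (g n) 1 μ = eLpNorm (⇑(g n) - ⇑(g 0) + ⇑(g 0)) 1 μ := by rw [sub_add_cancel]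
        _ ≤ eLpNorm (⇑(g n) - ⇑(g 0)) 1 μ + eLpNorm (g 0) 1 μ :=
          eLpNorm_add_le ((hg n).sub (hg 0)) (hg 0) le_rfl
        _ ≤ ENNReal.ofReal ‖b 0 + b 0‖ + eLpNorm (g 0) 1 μ := by
          gcongr
          rw [eLpNorm_one_eq_lintegral_enorm]
          have h0 := OrderHenstock.lintegral_edist_comp_le hμ hL (hγ 0) (h 0) (hτ0 n) (hτ0 0)
          simp only [edist_eq_enorm_sub] at h0
          exact h0
  refine (eLpNorm_le_of_tendstoInMeasure (Eventually.of_forall hbound) hmeas hg).trans_lt ?_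
  refine ENNReal.add_lt_top.2 ⟨ENNReal.ofReal_lt_top, ?_⟩
  exact (memLp_one_iff_integrable.2 (SimpleFunc.integrable_of_isFiniteMeasure (g 0))).2
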